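/- Let $G$ be a finite simple graph with vertex set $V$. The algorithm $2$-WL (Weisfeiler-Leman) colors the ordered pairs of vertices as follows. Initially, $(x,y)$ gets one of three colors $c_0(x,y)$ according to whether $x=y$, $x$ and $y$ are adjacent, or $x$ and $y$ are distinct and non-adjacent; then $$c_{i+1}(x,y)=\bigl(c_i(x,y),\ \{\!\{(c_i(x,z),c_i(z,y)) : z\in V\}\!\}\bigr),$$ where $\{\!\{\cdot\}\!\}$ denotes a multiset. Let $t$ be the least index such that $c_t$ and $c_{t+1}$ induce the same partition of $V\times V$; the final color of $(x,y)$ is $c_t(x,y)$. Call $G$ *$\mathrm{WL}_2$-vertex-regular* if all pairs $(x,x)$, $x\in V$, have the same final color. By an $s$-path (resp. $s$-cycle) in $G$ we mean a (not necessarily induced) subgraph of $G$ isomorphic to the path graph (resp. cycle graph) on $s$ vertices. An $s$-path emanates from $x$ if $x$ is an end vertex of it (for $s=1$, its only vertex; for $s=0$ there are no such paths). **Theorem.** Let $G$ be a finite $\mathrm{WL}_2$-vertex-regular graph. 1. For each $s\le 7$, the number of $s$-paths emanating from a vertex $x$ of $G$ is the same for every $x$. 2. For each $3\le s\le 7$,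 the number of $s$-cycles containing a vertex $x$ of $G$ is the same for every $x$. Moreover, every constituent graph of an association scheme is $\mathrm{WL}_2$-vertex-regular. Here an association scheme on a finite set $V$ is a coloring $\alpha$ of $V\times V$ such that (i) the pairs $(x,x)$, $x\in V$, form a color class; (ii) $\alpha(x,y)=\alpha(x',y')$ implies $\alpha(y,x)=\alpha(y',x')$; (iii) $\alpha(x,y)=\alpha(x',y')$ implies $\{\!\{(\alpha(x,z),\alpha(z,y)) : z\in V\}\!\}=\{\!\{(\alpha(x',z),\alpha(z,y')) : z\in V\}\!\}$. A constituent graph of it is a graph on $V$ in which, for some color $c$ of a pair $(a,b)$ with $a\ne b$, vertices $x$ and $y$ are adjacent if and only if $\alpha(x,y)=c$ or $\alpha(y,x)=c$. -/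

import Mathlib

noncomputable section

namespace WL

/-- One refinement step of the 2-dimensional Weisfeiler-Leman algorithm, applied to an arbitrary
coloring `c` of the ordered pairs of elements of a finite set `V`: the new color of `(x, y)` is
the old color together with the multiset of the color pairs `(c x z, c z y)` over all `z`. -/
def refine {V : Type*} [Fintype V] {C : Type*} (c : V → V → C) :
    V → V → C × Multiset (C × C) :=
  fun x y => (c x y, (Finset.univ : Finset V).val.map fun z => (c x z, c z y))

/-- The set of colors available after `i` refinement steps. -/
def Color : ℕ → Type
  | 0 => Fin 3
  | i + 1 => Color i × Multiset (Color i × Color i)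

open Classical in
/-- The initial color of a pair: equal, adjacent, or distinct and non-adjacent. -/
def initColor {V : Type*} (G : SimpleGraph V) (x y : V) : Fin 3 :=
  if x = y then 0 else if G.Adj x y then 1 else 2

/-- The color of the pair `(x, y)` after `i` refinement steps. -/
def color {V : Type*} [Fintype V] (G : SimpleGraph V) : (i : ℕ) → V → V → Color i
  | 0 => initColor G
  | i + 1 => refine (color G i)

/-- The partition of the set of ordered pairs of vertices into color classes after `i` steps,
given as an equivalence relation. -/
def partition {V : Type*} [Fintype V] (G : SimpleGraph V) (i : ℕ) : Setoid (V × V) :=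
  Setoid.ker fun p => color G i p.1 p.2

theorem partition_succ_le {V : Type*} [Fintype V] (G : SimpleGraph V) (i : ℕ) :
    partition G (i + 1) ≤ partition G i := by
  intro p q h
  exact congrArg Prod.fst (show refine (color G i) p.1 p.2 = refine (color G i) q.1 q.2 from h)

theorem exists_partition_succ_eq {V : Type*} [Fintype V] (G : SimpleGraph V) :
    ∃ t, partition G (t + 1) = partition G t := by
  by_contra! h
  have hs : StrictAnti (partition G) :=
    strictAnti_nat_of_succ_lt fun i => lt_of_le_of_ne (partition_succ_le G i) (h i)
  have : Finite (Setoid (V × V)) :=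
    Finite.of_injective (fun s : Setoid (V × V) => s.r) fun s t hst => by
      ext a b
      exact iff_of_eq (congrFun (congrFun hst a) b)
  exact not_injective_infinite_finite _ hs.injective

open Classical in
/-- The first step after which the color partition does not get finer. -/
def stabTime {V : Type*} [Fintype V] (G : SimpleGraph V) : ℕ :=
  Nat.find (exists_partition_succ_eq G)

/-- The final color of a pair of vertices. -/
def stableColor {V : Type*} [Fintype V] (G : SimpleGraph V) (x y : V) : Color (stabTime G) :=
  color G (stabTime G) x y

/-- `G` is `WL₂`-vertex-regular: all pairs `(x, x)` get the same final color. -/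
def VertexRegular {V : Type*} [Fintype V] (G : SimpleGraph V) : Prop :=
  ∀ x y : V, stableColor G x x = stableColor G y y

/-- The coloring `α` of all ordered pairs of elements of `V` is an association scheme. -/
structure IsAssociationScheme {V : Type*} [Fintype V] {C : Type*} (α : V → V → C) : Prop where
  /-- the loops form a separate color class -/
  loops : ∀ x y z : V, α x y = α z z ↔ x = y
  /-- the color of a pair determines the color of its transpose -/
  transpose : ∀ x y x' y' : V, α x y = α x' y' → α y x = α y' x'
  /-- a refinement step does not split any color class -/
  stable : ∀ x y x' y' : V, α x y = α x' y' → refine α x y = refine α x' y'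

/-- `G` is the undirected graph underlying the color class of some pair `(a, b)` with `a ≠ b`. -/
def IsConstituent {V : Type*} {C : Type*} (α : V → V → C) (G : SimpleGraph V) : Prop :=
  ∃ a b : V, a ≠ b ∧ ∀ x y : V, G.Adj x y ↔ α x y = α a b ∨ α y x = α a b

/-- The number of `s`-paths emanating from `x`: subgraphs of `G` (not necessarily induced) that
are isomorphic to the path graph on `s` vertices, with `x` corresponding to an end vertex. -/
def pathCount {V : Type*} (G : SimpleGraph V) (s : ℕ) (x : V) : ℕ :=
  {S : G.Subgraph | ∃ (φ : SimpleGraph.pathGraph s ≃g S.coe) (i : Fin s),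
    (i : ℕ) = 0 ∧ (φ i : V) = x}.ncard

/-- The number of `s`-cycles containing `x`: subgraphs of `G` (not necessarily induced) that are
isomorphic to the cycle graph on `s` vertices and contain `x`. -/
def cycleCount {V : Type*} (G : SimpleGraph V) (s : ℕ) (x : V) : ℕ :=
  {S : G.Subgraph | Nonempty (SimpleGraph.cycleGraph s ≃g S.coe) ∧ x ∈ S.verts}.ncard

end WL

end

/-!
The final coloring of a `WL₂`-vertex-regular graph is an association scheme
(`VertexRegular.isAssociationScheme`), and conversely the refinement started from a constituent
graph of a scheme never gets finer than the scheme, because the scheme is stable under refinement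
(`IsConstituent.color_eq`).

The counting statements hold for every graph `F` of maximum degree two on at most seven vertices,
with a root `r`. The number of subgraphs isomorphic to `(F, r)` and rooted at `x` is, up to the
factor `|Aut (F, r)|`, the number of injective homomorphisms `F → G` taking `r` to `x`
(`card_copy_eq_mul_rootedCount`). This number is an instance of `patternSum`, a sum over the
injective maps `f` from a pattern to `V` of products of weights `w i j (f i) (f j)`, where all
matrices `w i j` are constant on the color classes. Such matrices are closed under transposition,
entrywise and ordinary multiplication, and have constant diagonals.

The pattern sum is shown to be independent of `x` by removing vertices (`patternSum_eq`). Let `v`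
be a vertex other than the root with at most two neighbors `a` and `b`. Summing over all places of
`v` turns its two links into one matrix product, a new weight on `(a, b)`, and the placements that
put `v` on another vertex `l` are corrected for by the pattern in which `v` is identified with `l`
(`patternSum_succ`). All patterns that arise have their edges in a quotient of `F`, so it remains
to find such a `v` in every quotient of `F`. If there is none, every vertex other than the root has
at least three neighbors, hence at least two preimages in `F`; as `F` has at most seven vertices,
the quotient has exactly four vertices, all adjacent to the root, whereas the root has only one
preimage and thus at most two neighbors (`exists_ne_card_imageAdj_le_two`).
-/

noncomputable section

namespace WL

/-! ### Colorings stable under refinement -/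

theorem eq_iff_of_initColor_eq {V : Type*} (G : SimpleGraph V) {x y x' y' : V}
    (h : initColor G x y = initColor G x' y') : x = y ↔ x' = y' := by
  unfold initColor at h
  split_ifs at h <;> simp_all

theorem adj_iff_of_initColor_eq {V : Type*} (G : SimpleGraph V) {x y x' y' : V}
    (h : initColor G x y = initColor G x' y') : G.Adj x y ↔ G.Adj x' y' := by
  unfold initColor at h
  split_ifs at h <;> simp_all

section Scheme

variable {V : Type*} [Fintype V] {C : Type*}

theorem _root_.Multiset.exists_perm_of_map_univ_eq {β : Type*} {f g : V → β}
    (h : (Finset.univ : Finset V).val.map f = (Finset.univ : Finset V).val.map g) :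
    ∃ e : Equiv.Perm V, ∀ z, f z = g (e z) := by
  classical
  have hcard (b : β) : Fintype.card {a // f a = b} = Fintype.card {a // g a = b} := by
    have := congrArg (Multiset.count b) h
    rw [Multiset.count_map, Multiset.count_map] at this
    simpa [Fintype.card_subtype, Finset.card_def, eq_comm (a := b)] using this
  let e : Equiv.Perm V := Equiv.ofFiberEquiv fun b => Fintype.equivOfCardEq (hcard b)
  exact ⟨e, fun z => (Equiv.ofFiberEquiv_map _ z).symm⟩

/-- Equal refined colors are witnessed by a bijection of the middle vertices. -/
theorem refine_eq_iff (c : V → V → C) (x y x' y' : V) :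
    refine c x y = refine c x' y' ↔ c x y = c x' y' ∧
      ∃ e : Equiv.Perm V, ∀ z, c x z = c x' (e z) ∧ c z y = c (e z) y' := by
  rw [refine, refine, Prod.mk.injEq]
  refine and_congr_right fun _ => ⟨fun h => ?_, ?_⟩
  · simpa using Multiset.exists_perm_of_map_univ_eq h
  · rintro ⟨e, he⟩
    simp only [he]
    conv_rhs => rw [← Multiset.map_univ_val_equiv e, Multiset.map_map]
    rfl

/-- After any number of steps, the color of a pair determines that of its transpose. -/
theorem color_transpose (G : SimpleGraph V) (i : ℕ) :
    ∀ x y x' y' : V, color G i x y = color G i x' y' → color G i y x = color G i y' x' := by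
  induction i with
  | zero =>
    intro x y x' y' h
    change initColor G x y = initColor G x' y' at h
    change initColor G y x = initColor G y' x'
    have swap (u v : V) : initColor G u v = initColor G v u := by
      unfold initColor
      split_ifs <;> simp_all [G.adj_comm]
    rw [swap y x, swap y' x', h]
  | succ i ih =>
    intro x y x' y' h
    obtain ⟨h0, e, he⟩ := (refine_eq_iff (color G i) x y x' y').1 h
    exact (refine_eq_iff (color G i) y x y' x').2
      ⟨ih _ _ _ _ h0, e, fun z => ⟨ih _ _ _ _ (he z).2, ih _ _ _ _ (he z).1⟩⟩

theorem initColor_eq_of_color_eq (G : SimpleGraph V) (i : ℕ) {x y x' y' : V}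
    (h : color G i x y = color G i x' y') : initColor G x y = initColor G x' y' := by
  induction i with
  | zero => exact h
  | succ i ih => exact ih ((refine_eq_iff (color G i) x y x' y').1 h).1

/-- The final coloring of a `WL₂`-vertex-regular graph is an association scheme, so everything
about such graphs can be derived from the scheme axioms. -/
theorem VertexRegular.isAssociationScheme {G : SimpleGraph V} (hG : VertexRegular G) :
    IsAssociationScheme (stableColor G) where
  loops x y z := by
    refine ⟨fun h => (eq_iff_of_initColor_eq G (initColor_eq_of_color_eq G _ h)).2 rfl, ?_⟩
    rintro rfl
    exact hG x z
  transpose := color_transpose G _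
  stable x y x' y' h := by
    classical
    have hp := Nat.find_spec (exists_partition_succ_eq G)
    have : (partition G (stabTime G + 1)) (x, y) (x', y') := by
      rw [show partition G (stabTime G + 1) = partition G (stabTime G) from by
        unfold stabTime; convert hp]
      exact h
    exact this

theorem adj_iff_of_stableColor_eq (G : SimpleGraph V) {x y x' y' : V}
    (h : stableColor G x y = stableColor G x' y') : G.Adj x y ↔ G.Adj x' y' :=
  adj_iff_of_initColor_eq G (initColor_eq_of_color_eq G _ h)

/-- Refinement starting from a constituent graph never gets finer than the scheme. -/
theorem IsConstituent.color_eq {α : V → V → C} (hα : IsAssociationScheme α) {G : SimpleGraph V}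
    (hG : IsConstituent α G) (i : ℕ) :
    ∀ x y x' y' : V, α x y = α x' y' → color G i x y = color G i x' y' := by
  induction i with
  | zero =>
    intro x y x' y' h
    obtain ⟨a, b, -, hab⟩ := hG
    have heq : x = y ↔ x' = y' := by
      rw [← hα.loops x y x, ← hα.loops x' y' x, h]
    have hadj : G.Adj x y ↔ G.Adj x' y' := by
      rw [hab, hab, h, hα.transpose x y x' y' h]
    change initColor G x y = initColor G x' y'
    unfold initColor
    split_ifs <;> simp_all
  | succ i ih =>
    intro x y x' y' h
    obtain ⟨-, e, he⟩ := (refine_eq_iff α x y x' y').1 (hα.stable _ _ _ _ h)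
    exact (refine_eq_iff (color G i) x y x' y').2
      ⟨ih _ _ _ _ h, e, fun z => ⟨ih _ _ _ _ (he z).1, ih _ _ _ _ (he z).2⟩⟩

theorem IsConstituent.vertexRegular {α : V → V → C} (hα : IsAssociationScheme α)
    {G : SimpleGraph V} (hG : IsConstituent α G) : VertexRegular G := fun x y =>
  hG.color_eq hα _ x x y y ((hα.loops x x y).2 rfl)

end Scheme

/-! ### Matrices constant on color classes -/

section Weights

variable {V : Type*} {C : Type*}

/-- The matrix `M` is constant on the color classes of `c`. For an association scheme `c` these
matrices form its adjacency algebra. -/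
def ConstOn (c : V → V → C) (M : V → V → ℤ) : Prop :=
  ∀ x y x' y', c x y = c x' y' → M x y = M x' y'

variable {c : V → V → C} {M N : V → V → ℤ}

theorem ConstOn.one : ConstOn c (fun _ _ => 1) := fun _ _ _ _ _ => rfl

theorem ConstOn.mul (hM : ConstOn c M) (hN : ConstOn c N) :
    ConstOn c (fun x y => M x y * N x y) := fun x y x' y' h => by
  simp only [hM x y x' y' h, hN x y x' y' h]

theorem ConstOn.ite (p : Prop) [Decidable p] (hM : ConstOn c M) (hN : ConstOn c N) :
    ConstOn c (if p then M else N) := by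
  split_ifs
  · exact hM
  · exact hN

variable [Fintype V]

theorem ConstOn.transpose (hc : IsAssociationScheme c) (hM : ConstOn c M) :
    ConstOn c (fun x y => M y x) :=
  fun _ _ _ _ h => hM _ _ _ _ (hc.transpose _ _ _ _ h)

theorem ConstOn.diag (hc : IsAssociationScheme c) (hM : ConstOn c M) (x y : V) : M x x = M y y :=
  hM _ _ _ _ ((hc.loops x x y).2 rfl)

theorem ConstOn.sum_mul (hc : IsAssociationScheme c) (hM : ConstOn c M) (hN : ConstOn c N) :
    ConstOn c (fun x y => ∑ z, M x z * N z y) := fun x y x' y' h => by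
  obtain ⟨-, e, he⟩ := (refine_eq_iff c x y x' y').1 (hc.stable _ _ _ _ h)
  refine Fintype.sum_equiv e _ _ fun z => ?_
  rw [hM _ _ _ _ (he z).1, hN _ _ _ _ (he z).2]

end Weights

/-! ### Eliminating a vertex of small degree from a weighted pattern -/

section Pattern

variable {V : Type*}

open Classical in
/-- The weighted count of placements of `k` distinct vertices with the `r`-th one at `x`: each
placement `f` contributes the product of the weights `w i j (f i) (f j)` over all ordered pairs
`(i, j)`, including `i = j`. -/
def patternSum [Fintype V] {k : ℕ} (w : Fin k → Fin k → V → V → ℤ) (r : Fin k) (x : V) : ℤ :=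
  ∑ f : Fin k → V, if Function.Injective f ∧ f r = x then ∏ i, ∏ j, w i j (f i) (f j) else 0

theorem patternSum_fin_one [Fintype V] (w : Fin 1 → Fin 1 → V → V → ℤ) (r : Fin 1) (x : V) :
    patternSum w r x = w 0 0 x x := by
  unfold patternSum
  rw [Fintype.sum_eq_single (fun _ => x)]
  · simp [Function.injective_of_subsingleton]
  · intro f hf
    refine if_neg fun h => hf (funext fun i => ?_)
    rw [Subsingleton.elim i r, h.2]

/-- The combined weight of the two ordered pairs formed by vertex `v` and another vertex `i`. -/
def link {k : ℕ} (w : Fin (k + 1) → Fin (k + 1) → V → V → ℤ) (v : Fin (k + 1)) (i : Fin k)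
    (y z : V) : ℤ :=
  w (v.succAbove i) v y z * w v (v.succAbove i) z y

/-- The weights on the vertices other than `v` when `v` is identified with `l`. -/
def contractWeight {k : ℕ} (w : Fin (k + 1) → Fin (k + 1) → V → V → ℤ) (v : Fin (k + 1))
    (l : Fin k) (i j : Fin k) (y z : V) : ℤ :=
  w (v.succAbove i) (v.succAbove j) y z * (if j = l then link w v i else fun _ _ => 1) y z

/-- The weights on the vertices other than `v` with the additional weight `M` on `(a, b)`. -/
def insertWeight {k : ℕ} (w : Fin (k + 1) → Fin (k + 1) → V → V → ℤ) (v : Fin (k + 1))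
    (a b : Fin k) (M : V → V → ℤ) (i j : Fin k) (y z : V) : ℤ :=
  w (v.succAbove i) (v.succAbove j) y z * (if i = a ∧ j = b then M else fun _ _ => 1) y z

theorem prod_prod_eq_link_mul {k : ℕ} (w : Fin (k + 1) → Fin (k + 1) → V → V → ℤ)
    (v : Fin (k + 1)) (z : V) (g : Fin k → V) :
    ∏ i, ∏ j, w i j ((v.insertNth z g : Fin (k + 1) → V) i)
        ((v.insertNth z g : Fin (k + 1) → V) j) =
      w v v z z * ((∏ i, ∏ j, w (v.succAbove i) (v.succAbove j) (g i) (g j)) *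
        ∏ i, link w v i (g i) z) := by
  simp only [Fin.prod_univ_succAbove _ v, Fin.insertNth_apply_same,
    Fin.insertNth_apply_succAbove, link, Finset.prod_mul_distrib]
  ring

theorem prod_prod_contractWeight {k : ℕ} (w : Fin (k + 1) → Fin (k + 1) → V → V → ℤ)
    (v : Fin (k + 1)) (l : Fin k) (g : Fin k → V) :
    ∏ i, ∏ j, contractWeight w v l i j (g i) (g j) =
      (∏ i, ∏ j, w (v.succAbove i) (v.succAbove j) (g i) (g j)) *
        ∏ i, link w v i (g i) (g l) := by
  simp only [contractWeight, Finset.prod_mul_distrib]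
  congr 1
  refine Finset.prod_congr rfl fun i _ => ?_
  rw [Fintype.prod_eq_single l fun j hj => by simp [hj]]
  simp

theorem prod_prod_insertWeight {k : ℕ} (w : Fin (k + 1) → Fin (k + 1) → V → V → ℤ)
    (v : Fin (k + 1)) (a b : Fin k) (M : V → V → ℤ) (g : Fin k → V) :
    ∏ i, ∏ j, insertWeight w v a b M i j (g i) (g j) =
      (∏ i, ∏ j, w (v.succAbove i) (v.succAbove j) (g i) (g j)) * M (g a) (g b) := by
  simp only [insertWeight, Finset.prod_mul_distrib]
  congr 1
  rw [Fintype.prod_eq_single a fun i hi => by simp [hi],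
    Fintype.prod_eq_single b fun j hj => by simp [hj]]
  simp

theorem insertNth_injective_iff {k : ℕ} (v : Fin (k + 1)) (z : V) (g : Fin k → V) :
    Function.Injective (v.insertNth z g : Fin (k + 1) → V) ↔
      Function.Injective g ∧ ∀ j, z ≠ g j := by
  constructor
  · intro h
    refine ⟨fun i j hij => ?_, fun j hj => ?_⟩
    · exact Fin.succAbove_right_injective (p := v) (h (by simpa using hij))
    · exact Fin.succAbove_ne v j (h (a₁ := v.succAbove j) (a₂ := v) (by simpa using hj.symm))
  · rintro ⟨hg, hz⟩ i j
    induction i using v.succAboveCases <;> induction j using v.succAboveCases <;>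
      simp_all [hg.eq_iff, eq_comm]

/-- Deleting the vertex `v` from a pattern when its links to vertices other than `a` and `b` are
trivial. For a placement `g` of the other vertices, summing the weight over the places outside the
range of `g` is summing it over all places, which gives a function `M` of `g a` and `g b`, and
subtracting the cases where `v` is placed on another vertex. -/
theorem patternSum_succ [Fintype V] {k : ℕ} (w : Fin (k + 1) → Fin (k + 1) → V → V → ℤ)
    (v : Fin (k + 1)) (r : Fin k) (d : ℤ) (hd : ∀ z, w v v z z = d) (a b : Fin k)
    (hab : ∀ i, i ≠ a → i ≠ b → ∀ y z, link w v i y z = 1) (x : V) :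
    patternSum w (v.succAbove r) x = d * (patternSum (insertWeight w v a b fun y y' =>
        ∑ z, link w v a y z * (if a = b then fun _ _ => 1 else link w v b) y' z) r x -
      ∑ l, patternSum (contractWeight w v l) r x) := by
  classical
  set M : V → V → ℤ := fun y y' =>
    ∑ z, link w v a y z * (if a = b then fun _ _ => 1 else link w v b) y' z with hM
  have hall (g : Fin k → V) : ∑ z, ∏ i, link w v i (g i) z = M (g a) (g b) := by
    refine Finset.sum_congr rfl fun z _ => ?_
    split_ifs with h
    · subst h
      rw [Fintype.prod_eq_single a fun i hi => hab i hi hi _ _, mul_one]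
    · exact Fintype.prod_eq_mul a b h fun i hi => hab i hi.1 hi.2 _ _
  have hout (g : Fin k → V) (hg : Function.Injective g) :
      (∑ z, if ∀ j, z ≠ g j then ∏ i, link w v i (g i) z else 0) =
        M (g a) (g b) - ∑ l, ∏ i, link w v i (g i) (g l) := by
    rw [← hall, eq_sub_iff_add_eq, ← Finset.sum_filter,
      ← Finset.sum_image (s := Finset.univ) (g := g) (f := fun z => ∏ i, link w v i (g i) z)
        (fun _ _ _ _ h => hg h),
      show Finset.univ.image g = Finset.univ.filter (fun z => ¬ ∀ j, z ≠ g j) by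
        ext z; simp [eq_comm],
      Finset.sum_filter_add_sum_filter_not]
  have hterm (g : Fin k → V) :
      (∑ z, if Function.Injective (v.insertNth z g : Fin (k + 1) → V) ∧
          (v.insertNth z g : Fin (k + 1) → V) (v.succAbove r) = x then
        ∏ i, ∏ j, w i j ((v.insertNth z g : Fin (k + 1) → V) i)
          ((v.insertNth z g : Fin (k + 1) → V) j) else 0) =
      if Function.Injective g ∧ g r = x then
        d * (∏ i, ∏ j, insertWeight w v a b M i j (g i) (g j) -
          ∑ l, ∏ i, ∏ j, contractWeight w v l i j (g i) (g j)) else 0 := by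
    simp only [insertNth_injective_iff, Fin.insertNth_apply_succAbove, prod_prod_eq_link_mul,
      prod_prod_insertWeight, prod_prod_contractWeight, hd]
    split_ifs with h
    · rw [← Finset.mul_sum, ← mul_sub, ← hout g h.1, Finset.mul_sum, Finset.mul_sum]
      refine Finset.sum_congr rfl fun z _ => ?_
      by_cases hz : ∀ j, z ≠ g j <;> simp [h, hz]
    · refine Finset.sum_eq_zero fun z _ => if_neg fun h' => h ⟨h'.1.1, h'.2⟩
  unfold patternSum
  rw [← (Fin.insertNthEquiv (fun _ => V) v).sum_comp, Fintype.sum_prod_type, Finset.sum_comm]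
  refine (Finset.sum_congr rfl fun g _ => hterm g).trans ?_
  rw [Finset.sum_comm, ← Finset.sum_sub_distrib, Finset.mul_sum]
  refine Finset.sum_congr rfl fun g _ => ?_
  split_ifs <;> simp

end Pattern

/-! ### Quotients of graphs of maximum degree two -/

section Quotient

variable {s : ℕ}

/-- Adjacency in the image of the graph `F` under `φ`. -/
def ImageAdj {k : ℕ} (F : SimpleGraph (Fin s)) (φ : Fin s → Fin k) (i j : Fin k) : Prop :=
  ∃ p q, F.Adj p q ∧ φ p = i ∧ φ q = j

theorem ImageAdj.symm {k : ℕ} {F : SimpleGraph (Fin s)} {φ : Fin s → Fin k} {i j : Fin k}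
    (h : ImageAdj F φ i j) : ImageAdj F φ j i := by
  obtain ⟨p, q, hpq, hp, hq⟩ := h
  exact ⟨q, p, hpq.symm, hq, hp⟩

theorem ImageAdj.comp {k l : ℕ} {F : SimpleGraph (Fin s)} {φ : Fin s → Fin k} {i j : Fin k}
    (h : ImageAdj F φ i j) (e : Fin k → Fin l) : ImageAdj F (e ∘ φ) (e i) (e j) := by
  obtain ⟨p, q, hpq, hp, hq⟩ := h
  exact ⟨p, q, hpq, congrArg e hp, congrArg e hq⟩

/-- `F` has maximum degree at most two. -/
def DegreeLeTwo (F : SimpleGraph (Fin s)) : Prop :=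
  ∀ a, ∃ p q, ∀ b, F.Adj a b → b = p ∨ b = q

open Classical in
/-- A vertex with only one preimage has at most two neighbors in a quotient of a graph of maximum
degree two. -/
theorem card_imageAdj_le_two_of_fiber {k : ℕ} {F : SimpleGraph (Fin s)} (hF : DegreeLeTwo F)
    (φ : Fin s → Fin k) (v : Fin k) (h : (Finset.univ.filter fun p => φ p = v).card ≤ 1) :
    (Finset.univ.filter fun i => ImageAdj F φ v i).card ≤ 2 := by
  rcases (Finset.univ.filter fun i => ImageAdj F φ v i).eq_empty_or_nonempty with h0 | ⟨i, hi⟩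
  · simp [h0]
  obtain ⟨p, q, -, hp, -⟩ := (Finset.mem_filter.1 hi).2
  obtain ⟨q₁, q₂, hq⟩ := hF p
  refine (Finset.card_le_card (t := {φ q₁, φ q₂}) fun j hj => ?_).trans Finset.card_le_two
  obtain ⟨p', q', hpq, hp', rfl⟩ := (Finset.mem_filter.1 hj).2
  obtain rfl : p' = p := Finset.card_le_one.1 h p' (by simp [hp']) p (by simp [hp])
  rcases hq _ hpq with rfl | rfl <;> simp

open Classical in
/-- In a quotient of a graph of maximum degree two on at most seven vertices, some vertex other
than the root has at most two neighbors. Otherwise every other vertex has at least two preimages,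
so there are at most three of them besides the root. As each has three neighbors, the root is
adjacent to all three; but the root has only one preimage, hence at most two neighbors. -/
theorem exists_ne_card_imageAdj_le_two {k : ℕ} (hk : k ≠ 0) (hs : s ≤ 7)
    {F : SimpleGraph (Fin s)} (hF : DegreeLeTwo F) (φ : Fin s → Fin (k + 1))
    (hφ : Function.Surjective φ) (r : Fin (k + 1)) :
    ∃ v ≠ r, (Finset.univ.filter fun i => ImageAdj F φ v i ∧ i ≠ v).card ≤ 2 := by
  by_contra! H
  have hfib (v : Fin (k + 1)) (hv : v ≠ r) : 2 ≤ (Finset.univ.filter fun p => φ p = v).card := by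
    by_contra! h
    have h1 := card_imageAdj_le_two_of_fiber hF φ v (by omega)
    have h2 : (Finset.univ.filter fun i => ImageAdj F φ v i ∧ i ≠ v).card ≤
        (Finset.univ.filter fun i => ImageAdj F φ v i).card :=
      Finset.card_le_card fun i => by simp +contextual
    have := H v hv
    omega
  have htot : ∑ v, (Finset.univ.filter fun p => φ p = v).card = s := by
    rw [← Finset.card_eq_sum_card_fiberwise fun _ _ => Finset.mem_coe.2 (Finset.mem_univ _)]
    simp
  rw [Fin.sum_univ_succAbove _ r] at htot
  have hsum : k * 2 ≤ ∑ i, (Finset.univ.filter fun p => φ p = r.succAbove i).card := by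
    simpa using Finset.card_nsmul_le_sum Finset.univ
      (fun i : Fin k => (Finset.univ.filter fun p => φ p = r.succAbove i).card) 2
      fun i _ => hfib _ (Fin.succAbove_ne r i)
  have hr : 0 < (Finset.univ.filter fun p => φ p = r).card := by
    obtain ⟨p, hp⟩ := hφ r
    exact Finset.card_pos.2 ⟨p, by simp [hp]⟩
  -- some vertex has three neighbors, so `k ≥ 3`; with `2 * k < s ≤ 7` the root has one preimage
  have hroot : (Finset.univ.filter fun i => ImageAdj F φ r i).card < k := by
    have h0 := H (r.succAbove ⟨0, by omega⟩) (Fin.succAbove_ne r _)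
    have h1 : (Finset.univ.filter fun i => ImageAdj F φ (r.succAbove ⟨0, by omega⟩) i ∧
        i ≠ r.succAbove ⟨0, by omega⟩).card ≤ k := by
      refine (Finset.card_le_card (t := {r.succAbove ⟨0, by omega⟩}ᶜ) fun i hi => ?_).trans ?_
      · simpa using (Finset.mem_filter.1 hi).2.2
      · simp [Finset.card_compl]
    have := card_imageAdj_le_two_of_fiber hF φ r (by omega)
    omega
  obtain ⟨i, hi⟩ : ∃ i, ¬ ImageAdj F φ r (r.succAbove i) := by
    by_contra! h
    refine hroot.not_ge ?_
    calc k = (Finset.univ.image r.succAbove).card := by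
          rw [Finset.card_image_of_injective _ Fin.succAbove_right_injective]; simp
      _ ≤ _ := Finset.card_le_card fun j hj => by
          obtain ⟨i, -, rfl⟩ := Finset.mem_image.1 hj
          simpa using h i
  have h0 := H _ (Fin.succAbove_ne r i)
  have h1 : (Finset.univ.filter fun j => ImageAdj F φ (r.succAbove i) j ∧
      j ≠ r.succAbove i).card ≤ k - 1 := by
    refine (Finset.card_le_card (t := {r.succAbove i, r}ᶜ) fun j hj => ?_).trans ?_
    · have hj := (Finset.mem_filter.1 hj).2
      simp only [Finset.mem_compl, Finset.mem_insert, Finset.mem_singleton, not_or]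
      refine ⟨hj.2, ?_⟩
      rintro rfl
      exact hi hj.1.symm
    · rw [Finset.card_compl, Finset.card_pair (Fin.succAbove_ne r i)]
      simp
  omega

end Quotient

/-! ### Pattern sums over an association scheme -/

section Constancy

variable {V : Type*} {C : Type*} {c : V → V → C} {k : ℕ}
  {w : Fin (k + 1) → Fin (k + 1) → V → V → ℤ}

theorem ConstOn.link [Fintype V] (hc : IsAssociationScheme c) (hw : ∀ i j, ConstOn c (w i j))
    (v : Fin (k + 1)) (i : Fin k) : ConstOn c (link w v i) :=
  (hw _ _).mul ((hw _ _).transpose hc)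

theorem ConstOn.contractWeight [Fintype V] (hc : IsAssociationScheme c)
    (hw : ∀ i j, ConstOn c (w i j)) (v : Fin (k + 1)) (l i j : Fin k) :
    ConstOn c (contractWeight w v l i j) :=
  (hw _ _).mul (.ite _ (.link hc hw v i) .one)

theorem ConstOn.insertWeight (hw : ∀ i j, ConstOn c (w i j)) (v : Fin (k + 1)) (a b : Fin k)
    {M : V → V → ℤ} (hM : ConstOn c M) (i j : Fin k) :
    ConstOn c (insertWeight w v a b M i j) :=
  (hw _ _).mul (.ite _ hM .one)

theorem exists_pair_of_card_le_two {α : Type*} [Nonempty α] {T : Finset α} (h : T.card ≤ 2) :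
    ∃ a b, (a = b ∨ a ∈ T ∧ b ∈ T) ∧ ∀ i ∈ T, i = a ∨ i = b := by
  classical
  have : T.card = 0 ∨ T.card = 1 ∨ T.card = 2 := by omega
  rcases this with h | h | h
  · obtain rfl := Finset.card_eq_zero.1 h
    obtain ⟨a⟩ := ‹Nonempty α›
    exact ⟨a, a, .inl rfl, by simp⟩
  · obtain ⟨a, rfl⟩ := Finset.card_eq_one.1 h
    exact ⟨a, a, .inl rfl, by simp⟩
  · obtain ⟨a, b, -, rfl⟩ := Finset.card_eq_two.1 h
    exact ⟨a, b, .inr (by simp), by simp⟩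

/-- Let the weights be constant on the classes of an association scheme, and trivial except on
loops and on the edges of a quotient of a graph `F` of maximum degree two with at most seven
vertices. Then the rooted pattern sum does not depend on the place of the root. By induction on
the number `k` of vertices: a vertex with at most two neighbors `a`, `b` is eliminated, which
leads to quotients of `F` with one vertex less. The weight `M` that the elimination puts on
`(a, b)` is allowed there because `ab` is an edge after identifying that vertex with `a`. -/
theorem patternSum_eq [Fintype V] (hc : IsAssociationScheme c) {s : ℕ} (hs : s ≤ 7)
    {F : SimpleGraph (Fin s)} (hF : DegreeLeTwo F) (x y : V) :
    ∀ (k : ℕ) (φ : Fin s → Fin k), Function.Surjective φ →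
      ∀ w : Fin k → Fin k → V → V → ℤ, (∀ i j, ConstOn c (w i j)) →
        (∀ i j, i ≠ j → ¬ ImageAdj F φ i j → ∀ u z, w i j u z = 1) →
          ∀ r : Fin k, patternSum w r x = patternSum w r y := by
  intro k
  induction k with
  | zero => exact fun _ _ _ _ _ r => r.elim0
  | succ k ih =>
    intro φ hφ w hw hsupp r
    rcases eq_or_ne k 0 with rfl | hk
    · rw [patternSum_fin_one, patternSum_fin_one]
      exact (hw 0 0).diag hc x y
    classical
    obtain ⟨v, hvr, hv⟩ := exists_ne_card_imageAdj_le_two hk hs hF φ hφ r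
    obtain ⟨r, rfl⟩ := Fin.exists_succAbove_eq hvr.symm
    have hT : (Finset.univ.filter fun i => ImageAdj F φ v (v.succAbove i)).card ≤ 2 := by
      refine le_trans ?_ hv
      rw [← Finset.card_image_of_injective _ (Fin.succAbove_right_injective (p := v))]
      refine Finset.card_le_card fun i hi => ?_
      obtain ⟨j, hj, rfl⟩ := Finset.mem_image.1 hi
      simpa [Fin.succAbove_ne] using hj
    have : Nonempty (Fin k) := ⟨r⟩
    obtain ⟨a, b, hab, hT⟩ := exists_pair_of_card_le_two hT
    simp only [Finset.mem_filter_univ] at hab hT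
    -- `contr l` identifies the vertex `v` with `l`
    let contr (l : Fin k) : Fin (k + 1) → Fin k := v.insertNth l id
    have contr_self (l : Fin k) : contr l v = l := Fin.insertNth_apply_same _ _ _
    have contr_succAbove (l i : Fin k) : contr l (v.succAbove i) = i :=
      Fin.insertNth_apply_succAbove _ _ _ _
    have contr_surj (l : Fin k) : Function.Surjective (contr l ∘ φ) :=
      Function.Surjective.comp (fun i => ⟨_, contr_succAbove l i⟩) hφ
    have hold (l i j : Fin k) (hij : i ≠ j) (h : ¬ ImageAdj F (contr l ∘ φ) i j) (u z : V) :
        w (v.succAbove i) (v.succAbove j) u z = 1 := by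
      refine hsupp _ _ (fun h' => hij (Fin.succAbove_right_injective h')) (fun h' => h ?_) u z
      simpa only [contr_succAbove] using h'.comp (contr l)
    have hlink (i : Fin k) (h : ¬ ImageAdj F φ v (v.succAbove i)) (u z : V) :
        link w v i u z = 1 := by
      rw [link, hsupp _ _ (Fin.succAbove_ne v i) (fun h' => h h'.symm),
        hsupp _ _ (Fin.succAbove_ne v i).symm h, one_mul]
    have key := patternSum_succ w v r (w v v x x) (fun z => (hw v v).diag hc z x) a b
      (fun i hia hib => hlink i fun h => (hT i h).elim hia hib)
    rw [key, key]
    congr 2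
    · refine ih (contr a ∘ φ) (contr_surj a) _ (ConstOn.insertWeight hw v a b ?_) ?_ r
      · exact (ConstOn.link hc hw v a).sum_mul hc
          ((ConstOn.ite (a = b) .one (.link hc hw v b)).transpose hc)
      · intro i j hij h u z
        rw [insertWeight, hold a i j hij h, one_mul, if_neg]
        rintro ⟨rfl, rfl⟩
        have hb := (hab.resolve_left hij).2.comp (contr i)
        rw [contr_self, contr_succAbove] at hb
        exact h hb
    · refine Finset.sum_congr rfl fun l _ => ?_
      refine ih (contr l ∘ φ) (contr_surj l) _ (ConstOn.contractWeight hc hw v l) ?_ r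
      intro i j hij h u z
      rw [contractWeight, hold l i j hij h, one_mul]
      split_ifs with hj
      · subst hj
        refine hlink i (fun h' => h ?_) u z
        have hi := h'.symm.comp (contr j)
        rwa [contr_self, contr_succAbove] at hi
      · rfl

end Constancy

/-! ### Counting rooted subgraphs by rooted copies -/

section Count

variable {V : Type*} {s : ℕ}

/-- The number of subgraphs of `G` that are isomorphic to `F` with `r` corresponding to `x`. -/
def rootedCount (G : SimpleGraph V) (F : SimpleGraph (Fin s)) (r : Fin s) (x : V) : ℕ :=
  {S : G.Subgraph | ∃ φ : F ≃g S.coe, (φ r : V) = x}.ncard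

/-- The copy of `F` parametrizing a subgraph isomorphic to `F`. -/
def copyOfIso {G : SimpleGraph V} {F : SimpleGraph (Fin s)} {S : G.Subgraph} (φ : F ≃g S.coe) :
    F.Copy G :=
  S.coeCopy.comp φ.toCopy

theorem toSubgraph_copyOfIso {G : SimpleGraph V} {F : SimpleGraph (Fin s)} {S : G.Subgraph}
    (φ : F ≃g S.coe) : (copyOfIso φ).toSubgraph = S := by
  ext u v
  · simp only [SimpleGraph.Copy.toSubgraph, SimpleGraph.Subgraph.map_verts]
    constructor
    · rintro ⟨a, -, rfl⟩
      exact (φ a).2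
    · intro hu
      exact ⟨φ.symm ⟨u, hu⟩, trivial, congrArg Subtype.val (φ.apply_symm_apply ⟨u, hu⟩)⟩
  · simp only [SimpleGraph.Copy.toSubgraph, SimpleGraph.Subgraph.map_adj]
    constructor
    · rintro ⟨a, b, hab, rfl, rfl⟩
      exact φ.map_rel_iff.2 hab
    · intro huv
      have hu := S.edge_vert huv
      have hv := S.edge_vert huv.symm
      refine ⟨φ.symm ⟨u, hu⟩, φ.symm ⟨v, hv⟩, ?_,
        congrArg Subtype.val (φ.apply_symm_apply ⟨u, hu⟩),
        congrArg Subtype.val (φ.apply_symm_apply ⟨v, hv⟩)⟩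
      exact φ.symm.map_rel_iff.2 huv

/-- Each subgraph isomorphic to the rooted graph `(F, r)` is parametrized by as many copies of `F`
as `(F, r)` has automorphisms. -/
theorem card_copy_eq_mul_rootedCount (G : SimpleGraph V) (F : SimpleGraph (Fin s)) (r : Fin s)
    (x : V) :
    Nat.card {f : F.Copy G // f r = x} =
      rootedCount G F r x * Nat.card {ψ : F ≃g F // ψ r = r} := by
  rw [rootedCount, ← Nat.card_coe_set_eq, ← Nat.card_prod]
  symm
  choose φ hφ using fun S : {S : G.Subgraph | ∃ φ : F ≃g S.coe, (φ r : V) = x} => S.2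
  refine Nat.card_congr (Equiv.ofBijective
    (fun p => ⟨copyOfIso (p.2.1.trans (φ p.1)), ?_⟩) ⟨?_, ?_⟩)
  · change ((φ p.1) (p.2.1 r) : V) = x
    rw [p.2.2, hφ]
  · rintro ⟨S, ψ⟩ ⟨S', ψ'⟩ h
    have h' := congrArg Subtype.val h
    have hS : S = S' := by
      have := congrArg SimpleGraph.Copy.toSubgraph h'
      rw [toSubgraph_copyOfIso, toSubgraph_copyOfIso] at this
      exact Subtype.ext this
    subst hS
    congr 1
    ext a : 2
    have := DFunLike.congr_fun h' a
    exact (φ S).injective (Subtype.ext this)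
  · rintro ⟨f, hf⟩
    have hmem : ∃ φ : F ≃g f.toSubgraph.coe, (φ r : V) = x := ⟨f.isoToSubgraph, hf⟩
    refine ⟨⟨⟨f.toSubgraph, hmem⟩, ⟨f.isoToSubgraph.trans (φ ⟨f.toSubgraph, hmem⟩).symm, ?_⟩⟩, ?_⟩
    · refine (φ ⟨f.toSubgraph, hmem⟩).symm_apply_eq.2 (Subtype.ext ?_)
      rw [hφ]
      exact hf
    · refine Subtype.ext (SimpleGraph.Copy.ext fun a => ?_)
      change ((φ ⟨f.toSubgraph, hmem⟩) ((φ ⟨f.toSubgraph, hmem⟩).symm (f.isoToSubgraph a)) : V) = _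
      rw [RelIso.apply_symm_apply]
      rfl

open Classical in
theorem card_copy_eq_patternSum [Fintype V] (G : SimpleGraph V) (F : SimpleGraph (Fin s))
    (r : Fin s) (x : V) :
    (Nat.card {f : F.Copy G // f r = x} : ℤ) =
      patternSum (fun i j u z => if F.Adj i j → G.Adj u z then 1 else 0) r x := by
  have hprod (f : Fin s → V) :
      (∏ i, ∏ j, if F.Adj i j → G.Adj (f i) (f j) then (1 : ℤ) else 0) =
        if ∀ i j, F.Adj i j → G.Adj (f i) (f j) then 1 else 0 := by
    simp [Finset.prod_ite_zero]
  simp only [patternSum, hprod, ← ite_and]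
  rw [Finset.sum_boole, Nat.cast_inj, ← Fintype.card_subtype, ← Nat.card_eq_fintype_card]
  exact Nat.card_congr
    { toFun f := ⟨f.1, ⟨f.1.injective, f.2⟩, fun i j h => f.1.toHom.map_adj h⟩
      invFun f := ⟨⟨⟨f.1, fun h => f.2.2 _ _ h⟩, f.2.1.1⟩, f.2.1.2⟩
      left_inv f := rfl
      right_inv f := rfl }

theorem rootedCount_eq [Fintype V] {G : SimpleGraph V} (hG : VertexRegular G) (hs : s ≤ 7)
    {F : SimpleGraph (Fin s)} (hF : DegreeLeTwo F) (r : Fin s) (x y : V) :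
    rootedCount G F r x = rootedCount G F r y := by
  classical
  have hpos : 0 < Nat.card {ψ : F ≃g F // ψ r = r} := by
    have : Nonempty {ψ : F ≃g F // ψ r = r} := ⟨⟨SimpleGraph.Iso.refl, rfl⟩⟩
    have : Finite (F ≃g F) := DFunLike.finite _
    exact Nat.card_pos
  refine Nat.eq_of_mul_eq_mul_right hpos ?_
  rw [← card_copy_eq_mul_rootedCount, ← card_copy_eq_mul_rootedCount, ← Nat.cast_inj (R := ℤ),
    card_copy_eq_patternSum, card_copy_eq_patternSum]
  refine patternSum_eq hG.isAssociationScheme hs hF x y s id Function.surjective_id _ ?_ ?_ r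
  · intro i j u z u' z' h
    simp only [adj_iff_of_stableColor_eq G h]
  · intro i j _ h u z
    exact if_pos fun hij => absurd ⟨i, j, hij, rfl, rfl⟩ h

end Count

/-! ### Paths and cycles -/

section PathCycle

variable {V : Type*}

theorem degreeLeTwo_cycleGraph (s : ℕ) : DegreeLeTwo (SimpleGraph.cycleGraph s) := by
  match s with
  | 0 => exact fun a => a.elim0
  | 1 => exact fun a => ⟨0, 0, fun b _ => .inl (Subsingleton.elim _ _)⟩
  | n + 2 =>
    refine fun a => ⟨a - 1, a + 1, fun b hb => ?_⟩
    have : b ∈ (SimpleGraph.cycleGraph (n + 2)).neighborSet a := hb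
    rwa [SimpleGraph.cycleGraph_neighborSet] at this

theorem degreeLeTwo_pathGraph (s : ℕ) : DegreeLeTwo (SimpleGraph.pathGraph s) := fun a =>
  let ⟨p, q, h⟩ := degreeLeTwo_cycleGraph s a
  ⟨p, q, fun b hb => h b (SimpleGraph.pathGraph_le_cycleGraph hb)⟩

theorem pathCount_zero (G : SimpleGraph V) (x : V) : pathCount G 0 x = 0 := by
  have : {S : G.Subgraph | ∃ (φ : SimpleGraph.pathGraph 0 ≃g S.coe) (i : Fin 0),
      (i : ℕ) = 0 ∧ (φ i : V) = x} = ∅ :=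
    Set.eq_empty_of_forall_notMem fun S ⟨_, i, _⟩ => i.elim0
  rw [pathCount, this, Set.ncard_empty]

theorem pathCount_succ (G : SimpleGraph V) (n : ℕ) (x : V) :
    pathCount G (n + 1) x = rootedCount G (SimpleGraph.pathGraph (n + 1)) 0 x := by
  unfold pathCount rootedCount
  congr 1
  ext S
  refine exists_congr fun φ => ⟨?_, fun h => ⟨0, rfl, h⟩⟩
  rintro ⟨i, hi, h⟩
  obtain rfl : i = 0 := Fin.ext hi
  exact h

/-- Rotation of the cycle graph. -/
def cycleRotation (n : ℕ) (a : Fin (n + 1)) :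
    SimpleGraph.cycleGraph (n + 1) ≃g SimpleGraph.cycleGraph (n + 1) where
  toEquiv := Equiv.addRight a
  map_rel_iff' := by
    intro u v
    simp only [Equiv.coe_addRight, SimpleGraph.cycleGraph_adj', add_sub_add_right_eq_sub]

/-- Cycle graphs being vertex-transitive, any vertex can be taken as the root. -/
theorem cycleCount_succ (G : SimpleGraph V) (n : ℕ) (x : V) :
    cycleCount G (n + 1) x = rootedCount G (SimpleGraph.cycleGraph (n + 1)) 0 x := by
  unfold cycleCount rootedCount
  congr 1
  ext S
  constructor
  · rintro ⟨⟨φ⟩, hx⟩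
    refine ⟨(cycleRotation n (φ.symm ⟨x, hx⟩)).trans φ, ?_⟩
    change ((φ (0 + φ.symm ⟨x, hx⟩)) : V) = x
    rw [zero_add, RelIso.apply_symm_apply]
  · rintro ⟨φ, rfl⟩
    exact ⟨⟨φ⟩, (φ 0).2⟩

end PathCycle

end WL

end

theorem mainTheorem2 {V : Type*} [Fintype V] (G : SimpleGraph V) :
    (WL.VertexRegular G →
      (∀ s : ℕ, s ≤ 7 → ∀ x y : V, WL.pathCount G s x = WL.pathCount G s y) ∧
      (∀ s : ℕ, 3 ≤ s → s ≤ 7 → ∀ x y : V, WL.cycleCount G s x = WL.cycleCount G s y)) ∧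
    (∀ {C : Type*} (α : V → V → C),
      WL.IsAssociationScheme α → WL.IsConstituent α G → WL.VertexRegular G) := by
  refine ⟨fun hG => ⟨fun s hs x y => ?_, fun s hs₃ hs x y => ?_⟩,
    fun α hα hG => hG.vertexRegular hα⟩
  · cases s with
    | zero => rw [WL.pathCount_zero, WL.pathCount_zero]
    | succ n =>
      rw [WL.pathCount_succ, WL.pathCount_succ]
      exact WL.rootedCount_eq hG hs (WL.degreeLeTwo_pathGraph _) _ _ _
  · obtain ⟨n, rfl⟩ : ∃ n, s = n + 1 := ⟨s - 1, by omega⟩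
    rw [WL.cycleCount_succ, WL.cycleCount_succ]
    exact WL.rootedCount_eq hG hs (WL.degreeLeTwo_cycleGraph _) _ _ _
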